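/- Let $\Lambda$ be a finite lattice, i.e. a finite connected graph with $N=|\Lambda|\ge 1$ sites, and let $\mathcal H=\bigotimes_{x\in\Lambda}\mathfrak h_x$ with $\mathfrak h_x=\mathfrak h=\mathbb C^d$. Fix a subspace $\mathfrak h^s\subseteq\mathfrak h$ of dimension $d_s$, a basis $\hat H^1,\dots,\hat H^{d_s-1}$ (Hermitian, traceless, commuting, vanishing on $(\mathfrak h^s)^\perp$) of a Cartan subalgebra of $\mathfrak{su}(\mathfrak h^s)$, and an orthonormal basis of $\mathfrak h^s$ of weight states $|\vec m\rangle$, $\hat H^i|\vec m\rangle=m^i|\vec m\rangle$. Let $\mathrm{Sym}^N(\mathfrak h^s)$ be the space of vectors of $\bigotimes_{x\in\Lambda}\mathfrak h^s$ that are invariant under all permutations of the sites; it is spanned by the totally symmetric weight states $$|\psi^\Lambda_{\vec m}\rangle\propto\sum_{\sigma\in\mathfrak S_N}\bigotimes_{x\in\Lambda}|\vec m_{\sigma(x)}\rangle_x,\qquad \sum_{x\in\Lambda}\vec m_x=\vec m .$$ Let $\hat H=\sum_{X\subseteq\Lambda}\hat h_X$ be a local operator on $\mathcal H$: each $\hat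 h_X$ acts non-trivially only on the sites of $X$, $\hat h_X=0$ unless $X$ is connected, and the interaction is not all-to-all, i.e. if $N\ge2$, there are two distinct sites that are not both contained in any $X$ with $\hat h_X\neq0$ (for example, all these $X$ have diameter smaller than that of $\Lambda$). Suppose that every $|\psi^\Lambda_{\vec m}\rangle$ is an eigenvector of $\hat H$. Then $$\hat H=\sum_{x\in\Lambda}\hat h^{(1)}_{[x]}\hat P_x+\sum_{\langle x,y\rangle}\hat h^{(2)}_{[xy]}\hat P_{xy}+\sum_{x\in\Lambda}\sum_{i=1}^{d_s-1}g_i\hat H^i_x+c\,\hat 1,$$ where $\langle x,y\rangle$ runs over the edges of $\Lambda$, $\hat h^{(1)}_{[x]}$ and $\hat h^{(2)}_{[xy]}$ are operators on $\mathcal H$ (not necessarily local), $\hat P_x$ and $\hat P_{xy}$ are orthogonal projectors that act non-trivially only on the site $x$ and on the pair $\{x,y\}$, respectively, and annihilate $\mathrm{Sym}^N(\mathfrak h^s)$, $\hat H^i_x$ is $\hat H^i$ acting on site $x$, and $g_i,c\in\mathbb C$. If $\hat H$ is Hermitian, then the $g_i$ and $c$ are real. -/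

import Mathlib

namespace ScarStates

/-- Pure states of one site, `𝔥 = ℂ^d` with its standard inner product. -/
abbrev Site (d : ℕ) : Type := EuclideanSpace ℂ (Fin d)

/-- The many-body Hilbert space `⨂_{x ∈ Λ} ℂ^d`, in its orthonormal product basis: a vector is
given by its amplitudes on the configurations `s : Λ → Fin d`. -/
abbrev ManyBody (Λ : Type) [Fintype Λ] (d : ℕ) : Type := EuclideanSpace ℂ (Λ → Fin d)

/-- Operators on the many-body space, as matrices in the product basis. -/
abbrev Op (Λ : Type) (d : ℕ) : Type := Matrix (Λ → Fin d) (Λ → Fin d) ℂ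

/-- The product vector `⨂_x v_x`. -/
noncomputable def prodState {Λ : Type} [Fintype Λ] {d : ℕ} (v : Λ → Site d) : ManyBody Λ d :=
  WithLp.toLp 2 (fun s => ∏ x, v x (s x))

/-- Permutation of the sites; on product vectors, `⨂_x v_x ↦ ⨂_x v_{σ x}`. -/
noncomputable def permState {Λ : Type} [Fintype Λ] {d : ℕ} (σ : Equiv.Perm Λ) (ψ : ManyBody Λ d) :
    ManyBody Λ d :=
  WithLp.toLp 2 (fun s => ψ (fun x => s (σ.symm x)))

/-- The operator `B ⊗ 1` that acts as `B` on the sites of `X` and trivially on all others. -/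
def localOp {Λ : Type} [Fintype Λ] [DecidableEq Λ] {d : ℕ} (X : Finset Λ)
    (B : Matrix (X → Fin d) (X → Fin d) ℂ) : Op Λ d :=
  fun s t => if ∀ y, y ∉ X → s y = t y then B (fun x => s x) (fun x => t x) else 0

/-- `A` acts non-trivially only on the sites of `X`. -/
def SupportedOn {Λ : Type} [Fintype Λ] [DecidableEq Λ] {d : ℕ} (X : Finset Λ) (A : Op Λ d) :
    Prop :=
  ∃ B : Matrix (X → Fin d) (X → Fin d) ℂ, A = localOp X B

/-- The one-site operator `M` acting on site `x`. -/
def siteOp {Λ : Type} [Fintype Λ] [DecidableEq Λ] {d : ℕ} (x : Λ)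
    (M : Matrix (Fin d) (Fin d) ℂ) : Op Λ d :=
  fun s t => if ∀ y, y ≠ x → s y = t y then M (s x) (t x) else 0

/-- A `k`-dimensional target space `𝔥ˢ ⊆ ℂ^d` with a Cartan subalgebra of `𝔰𝔲(𝔥ˢ)`: a basis of
`k - 1` traceless commuting Hermitian generators, which act within `𝔥ˢ` (they vanish on its
orthogonal complement), and an orthonormal basis of `𝔥ˢ` of simultaneous eigenvectors
(the weight states `|m⟩`) with their weight vectors. -/
structure CartanData (d k : ℕ) where
  /-- the weight states of `𝔥ˢ` -/
  vec : Fin k → Site d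
  orthonormal_vec : Orthonormal ℂ vec
  /-- the Cartan generators -/
  gen : Fin (k - 1) → Matrix (Fin d) (Fin d) ℂ
  /-- the weight vectors -/
  weight : Fin k → Fin (k - 1) → ℝ
  gen_vec : ∀ i a, (gen i).toEuclideanLin (vec a) = (weight a i : ℂ) • vec a
  gen_orthogonal : ∀ i, ∀ v ∈ (Submodule.span ℂ (Set.range vec))ᗮ, (gen i).toEuclideanLin v = 0
  trace_gen : ∀ i, (gen i).trace = 0
  linearIndependent_gen : LinearIndependent ℂ gen

/-- The target space `𝔥ˢ`. -/
def CartanData.target {d k : ℕ} (C : CartanData d k) : Submodule ℂ (Site d) :=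
  Submodule.span ℂ (Set.range C.vec)

/-- The subspace `⨂_x 𝔥ˢ` of the many-body space. -/
def tensorPower (Λ : Type) [Fintype Λ] {d : ℕ} (W : Submodule ℂ (Site d)) :
    Submodule ℂ (ManyBody Λ d) :=
  Submodule.span ℂ {ψ | ∃ v : Λ → Site d, (∀ x, v x ∈ W) ∧ ψ = prodState v}

/-- `ψ ∈ Sym^N(W)`: the totally symmetric vectors of `⨂_x W`. -/
def MemSymPower {Λ : Type} [Fintype Λ] {d : ℕ} (W : Submodule ℂ (Site d)) (ψ : ManyBody Λ d) :
    Prop :=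
  ψ ∈ tensorPower Λ W ∧ ∀ σ : Equiv.Perm Λ, permState σ ψ = ψ

/-- The totally symmetric weight state obtained by symmetrizing the product of the weight states
`vec (a x)`. It depends only on the total weight `∑ x, weight (a x)`; the normalization constant,
irrelevant for being an eigenvector, is omitted. -/
noncomputable def weightState {Λ : Type} [Fintype Λ] [DecidableEq Λ] {d k : ℕ}
    (C : CartanData d k) (a : Λ → Fin k) : ManyBody Λ d :=
  ∑ σ : Equiv.Perm Λ, permState σ (prodState fun x => C.vec (a x))

/-- The interaction terms `h_X` couple every pair of distinct sites directly. -/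
def AllToAll {Λ : Type} {d : ℕ} (h : Finset Λ → Op Λ d) : Prop :=
  Nontrivial Λ ∧ ∀ x y : Λ, x ≠ y → ∃ X, h X ≠ 0 ∧ x ∈ X ∧ y ∈ X

/-- The family `h_X`, `X ⊆ Λ`, is a local interaction on the lattice `G`: every `h_X` acts only
on `X`, only connected regions occur, and the interaction is not all-to-all, that is, some pair of
sites is contained in no region that occurs. (The last condition holds for instance if the
regions that occur have smaller diameter than the lattice.) -/
structure IsLocalInteraction {Λ : Type} [Fintype Λ] [DecidableEq Λ] {d : ℕ} (G : SimpleGraph Λ)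
    (h : Finset Λ → Op Λ d) : Prop where
  supported : ∀ X, SupportedOn X (h X)
  connected : ∀ X, h X ≠ 0 → (G.induce (X : Set Λ)).Connected
  not_allToAll : ¬ AllToAll h

/-- `P` is an orthogonal projector acting only on the sites of `X` that annihilates `Sym^N(W)`. -/
structure IsLocalAnnihilator {Λ : Type} [Fintype Λ] [DecidableEq Λ] {d : ℕ}
    (W : Submodule ℂ (Site d)) (X : Finset Λ) (P : Op Λ d) : Prop where
  isStarProjection : IsStarProjection P
  supported : SupportedOn X P
  annihilates : ∀ ψ : ManyBody Λ d, MemSymPower W ψ → P.toEuclideanLin ψ = 0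

end ScarStates

/-!
The one-site projectors `1 - P_x` onto the complement of the target space and the antisymmetrizers
`(1 - Π_{xy}) / 2` along the edges are positive, and since the transpositions along the edges of a
connected graph generate all permutations, their joint kernel is the span of the totally symmetric
weight states. So any operator that kills these states is a left combination of the projectors, and
it remains to match the eigenvalues `E a` of `H` with an on-site Cartan operator plus a constant.

`E a` is the sum of the matrix elements of `H` between a product weight state and its
rearrangements. The contribution of an operator supported on `X` to this sum depends only on the
values of `a` on `X`, because a rearrangement that contributes agrees with `a` off `X`. Two sites in
no common region therefore do not interact in `E`; one such pair exists, and as `E` is symmetric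
under permutations, no two sites interact. Hence `E` is a sum of one-site energies. The Cartan
generators together with the identity realise every function of the weight, so these energies come
from on-site Cartan operators.
-/

namespace ScarStates

open Finset Matrix
open scoped InnerProductSpace

section LinearAlgebra

theorem exists_eq_comp_of_ker_le {K V V' V'' : Type*} [DivisionRing K] [AddCommGroup V]
    [Module K V] [AddCommGroup V'] [Module K V'] [AddCommGroup V''] [Module K V'']
    {f : V →ₗ[K] V'} {g : V →ₗ[K] V''} (hfg : f.ker ≤ g.ker) : ∃ h : V' →ₗ[K] V'', g = h ∘ₗ f := by
  obtain ⟨r, hr⟩ := f.rangeRestrict.exists_rightInverse_of_surjective f.range_rangeRestrict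
  obtain ⟨h, hh⟩ := (g ∘ₗ r).exists_extend
  refine ⟨h, LinearMap.ext fun v => ?_⟩
  have hker : v - r (f.rangeRestrict v) ∈ f.ker := by
    have : f (r (f.rangeRestrict v)) = f v :=
      congrArg Subtype.val (LinearMap.congr_fun hr (f.rangeRestrict v))
    rw [LinearMap.mem_ker, map_sub, this, sub_self]
  calc g v = g (r (f.rangeRestrict v)) := sub_eq_zero.1 <| by rw [← map_sub]; exact hfg hker
    _ = h (f v) := (LinearMap.congr_fun hh (f.rangeRestrict v)).symm

theorem exists_eq_sum_mul_of_mulVec_eq_zero {K m n p ι : Type*} [Field K] [Fintype n] [Fintype p]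
    {A : Matrix m n K} {s : Finset ι} {P : ι → Matrix p n K}
    (hA : ∀ v, (∀ i ∈ s, P i *ᵥ v = 0) → A *ᵥ v = 0) :
    ∃ B : ι → Matrix m p K, A = ∑ i ∈ s, B i * P i := by
  classical
  obtain ⟨h, hh⟩ : ∃ h : (s → p → K) →ₗ[K] m → K,
      A.mulVecLin = h ∘ₗ LinearMap.pi fun i : s => (P i).mulVecLin :=
    exists_eq_comp_of_ker_le fun v hv => hA v fun i hi => congrFun hv ⟨i, hi⟩
  let B (i : s) : Matrix m p K := (h ∘ₗ LinearMap.single K _ i).toMatrix'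
  have hB : A = ∑ i, B i * P i := by
    refine Matrix.toLin'.injective (LinearMap.ext fun v => ?_)
    simp only [B, map_sum, Matrix.toLin'_mul, Matrix.toLin'_toMatrix', LinearMap.sum_apply,
      LinearMap.comp_apply, LinearMap.single_apply]
    rw [← map_sum, Finset.univ_sum_single]
    exact LinearMap.congr_fun hh v
  refine ⟨fun i => if hi : i ∈ s then B ⟨i, hi⟩ else 0, hB.trans ?_⟩
  rw [← Finset.sum_coe_sort s]
  simp

theorem isStarProjection_half_smul_one_sub {R : Type*} [Ring R] [StarRing R] [Algebra ℂ R]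
    [StarModule ℂ R] {u : R} (hu : IsSelfAdjoint u) (huu : u * u = 1) :
    IsStarProjection ((2⁻¹ : ℂ) • (1 - u)) := by
  refine ⟨?_, IsSelfAdjoint.smul (by simp [IsSelfAdjoint]) ((IsSelfAdjoint.one R).sub hu)⟩
  have hsq : (1 - u) * (1 - u) = (2 : ℂ) • (1 - u) := by
    rw [sub_mul, mul_sub, mul_sub, huu, one_mul, one_mul, mul_one, two_smul]
    abel
  rw [IsIdempotentElem, smul_mul_smul_comm, hsq, smul_smul]
  norm_num

end LinearAlgebra

section ProductOperators

variable {Λ : Type} [Fintype Λ] {d : ℕ}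

theorem prodState_smul (c : Λ → ℂ) (v : Λ → Site d) :
    prodState (fun x => c x • v x) = (∏ x, c x) • prodState v := by
  ext s
  simp [prodState, Finset.prod_mul_distrib]

theorem prodState_single (s : Λ → Fin d) :
    prodState (fun x => EuclideanSpace.single (s x) 1) = EuclideanSpace.single s 1 := by
  ext t
  simp [prodState, Finset.prod_ite_zero, funext_iff]

variable [DecidableEq Λ]

theorem prodState_sum_smul {ι : Type*} [Fintype ι] (c : Λ → ι → ℂ)
    (w : ι → Site d) :
    prodState (fun x => ∑ j, c x j • w j) =
      ∑ a : Λ → ι, (∏ x, c x (a x)) • prodState fun x => w (a x) := by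
  ext s
  simp only [prodState, WithLp.ofLp_sum, WithLp.ofLp_smul, Finset.sum_apply, Pi.smul_apply,
    smul_eq_mul, Finset.prod_univ_sum, Fintype.piFinset_univ, Finset.prod_mul_distrib]

theorem inner_prodState (v w : Λ → Site d) :
    ⟪prodState v, prodState w⟫_ℂ = ∏ x, ⟪v x, w x⟫_ℂ := by
  simp only [PiLp.inner_apply, prodState, Finset.prod_univ_sum, Fintype.piFinset_univ,
    RCLike.inner_apply, map_prod, Finset.prod_mul_distrib]

/-- The product operator `⨂_x K_x`. -/
def prodOp : (Λ → Matrix (Fin d) (Fin d) ℂ) →* Op Λ d where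
  toFun K := Matrix.of fun s t => ∏ x, K x (s x) (t x)
  map_one' := by
    ext s t
    simp [Matrix.one_apply, Finset.prod_ite_zero, funext_iff]
  map_mul' K L := by
    ext s t
    simp only [Matrix.of_apply, Pi.mul_apply, Matrix.mul_apply, Finset.prod_univ_sum,
      Fintype.piFinset_univ, Finset.prod_mul_distrib]

theorem prodOp_apply (K : Λ → Matrix (Fin d) (Fin d) ℂ) (s t : Λ → Fin d) :
    prodOp K s t = ∏ x, K x (s x) (t x) := rfl

theorem star_prodOp (K : Λ → Matrix (Fin d) (Fin d) ℂ) : star (prodOp K) = prodOp (star K) := by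
  ext s t
  simp [Matrix.star_apply, prodOp_apply]

theorem prodOp_prodState (K : Λ → Matrix (Fin d) (Fin d) ℂ) (v : Λ → Site d) :
    (prodOp K).toEuclideanLin (prodState v) = prodState fun x => (K x).toEuclideanLin (v x) := by
  ext s
  simp only [prodState, Matrix.ofLp_toLpLin, Matrix.toLin'_apply, Matrix.mulVec, dotProduct,
    prodOp_apply, Finset.prod_univ_sum, Fintype.piFinset_univ, Finset.prod_mul_distrib]

theorem siteOp_eq_prodOp (x : Λ) (K : Matrix (Fin d) (Fin d) ℂ) :
    siteOp x K = prodOp (Pi.mulSingle x K) := by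
  ext s t
  have hoff : ∀ y ∈ ({x}ᶜ : Finset Λ), (Pi.mulSingle x K : Λ → Matrix _ _ ℂ) y (s y) (t y) =
      if s y = t y then 1 else 0 := fun y hy => by
    rw [Pi.mulSingle_eq_of_ne (by simpa using hy), Matrix.one_apply]
  rw [prodOp_apply, Fintype.prod_eq_mul_prod_compl x, Pi.mulSingle_eq_same,
    Finset.prod_congr rfl hoff, Finset.prod_ite_zero]
  simp [siteOp]

theorem siteOp_prodState_of_eigen {x : Λ} {K : Matrix (Fin d) (Fin d) ℂ} {v : Λ → Site d} {μ : ℂ}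
    (hv : K.toEuclideanLin (v x) = μ • v x) :
    (siteOp x K).toEuclideanLin (prodState v) = μ • prodState v := by
  have hfac : ∀ y, ((Pi.mulSingle x K : Λ → Matrix _ _ ℂ) y).toEuclideanLin (v y) =
      (Pi.mulSingle x μ : Λ → ℂ) y • v y := fun y => by
    obtain rfl | hy := eq_or_ne y x
    · simpa using hv
    · simp [hy]
  rw [siteOp_eq_prodOp, prodOp_prodState, funext hfac, prodState_smul, Finset.prod_pi_mulSingle']
  simp

theorem isStarProjection_siteOp (x : Λ) {K : Matrix (Fin d) (Fin d) ℂ} (hK : IsStarProjection K) :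
    IsStarProjection (siteOp x K) := by
  rw [siteOp_eq_prodOp]
  refine ⟨?_, ?_⟩
  · rw [IsIdempotentElem, ← map_mul, ← Pi.mulSingle_mul, hK.isIdempotentElem.eq]
  · rw [IsSelfAdjoint, star_prodOp]
    congr 1
    ext y : 1
    obtain rfl | hy := eq_or_ne y x
    · simp [hK.isSelfAdjoint.star_eq]
    · simp [hy]

end ProductOperators

section Support

variable {Λ : Type} [Fintype Λ] [DecidableEq Λ] {d : ℕ}

theorem localOp_one (X : Finset Λ) : localOp (d := d) X 1 = 1 := by
  ext s t
  have hst : s = t ↔ (∀ y ∉ X, s y = t y) ∧ (fun x : X => s x) = fun x : X => t x := by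
    simp only [funext_iff, Subtype.forall]
    exact ⟨fun h => ⟨fun y _ => h y, fun y _ => h y⟩, fun h y => by
      by_cases hy : y ∈ X
      exacts [h.2 y hy, h.1 y hy]⟩
  simp only [localOp, Matrix.one_apply, hst, ite_and]

theorem localOp_sub (X : Finset Λ) (A B : Matrix (X → Fin d) (X → Fin d) ℂ) :
    localOp X (A - B) = localOp X A - localOp X B := by
  ext s t
  simp only [localOp, Matrix.sub_apply]
  split_ifs <;> simp

theorem localOp_smul (X : Finset Λ) (c : ℂ) (A : Matrix (X → Fin d) (X → Fin d) ℂ) :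
    localOp X (c • A) = c • localOp X A := by
  ext s t
  simp [localOp]

theorem SupportedOn.one (X : Finset Λ) : SupportedOn X (1 : Op Λ d) :=
  ⟨1, (localOp_one X).symm⟩

theorem SupportedOn.sub {X : Finset Λ} {A B : Op Λ d} (hA : SupportedOn X A)
    (hB : SupportedOn X B) : SupportedOn X (A - B) := by
  obtain ⟨A, rfl⟩ := hA
  obtain ⟨B, rfl⟩ := hB
  exact ⟨A - B, (localOp_sub X A B).symm⟩

theorem SupportedOn.smul {X : Finset Λ} {A : Op Λ d} (c : ℂ) (hA : SupportedOn X A) :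
    SupportedOn X (c • A) := by
  obtain ⟨A, rfl⟩ := hA
  exact ⟨c • A, (localOp_smul X c A).symm⟩

theorem supportedOn_siteOp (x : Λ) (K : Matrix (Fin d) (Fin d) ℂ) :
    SupportedOn {x} (siteOp x K) :=
  ⟨Matrix.of fun s t => K (s ⟨x, by simp⟩) (t ⟨x, by simp⟩), by
    ext s t
    simp [siteOp, localOp]⟩

theorem sum_restrict_restrict_compl {ι M : Type*} [Fintype ι] [AddCommMonoid M] (X : Finset Λ)
    (f : (X → ι) → ({y // y ∉ X} → ι) → M) :
    ∑ s : Λ → ι, f (fun x => s x) (fun y => s y) = ∑ u, ∑ r, f u r := by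
  rw [← Fintype.sum_prod_type']
  exact (Equiv.piEquivPiSubtypeProd (· ∈ X) fun _ => ι).sum_comp fun p => f p.1 p.2

theorem prodState_apply_eq_mul (X : Finset Λ) (w : Λ → Site d) (s : Λ → Fin d) :
    prodState w s = prodState (fun x : X => w x) (fun x => s x) *
      prodState (fun y : {y // y ∉ X} => w y) (fun y => s y) := by
  simp only [prodState]
  convert (Fintype.prod_subtype_mul_prod_subtype (· ∈ X) fun x => w x (s x)).symm

theorem localOp_prodState_apply (X : Finset Λ) (B : Matrix (X → Fin d) (X → Fin d) ℂ)
    (w : Λ → Site d) (s : Λ → Fin d) :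
    (localOp X B).toEuclideanLin (prodState w) s =
      B.toEuclideanLin (prodState fun x : X => w x) (fun x => s x) *
        prodState (fun y : {y // y ∉ X} => w y) (fun y => s y) := by
  have hoff : ∀ t : Λ → Fin d, (∀ y ∉ X, s y = t y) ↔
      (fun y : {y // y ∉ X} => s y) = fun y : {y // y ∉ X} => t y := by
    simp [funext_iff]
  simp only [Matrix.ofLp_toLpLin, Matrix.toLin'_apply, Matrix.mulVec, dotProduct, localOp, hoff,
    prodState_apply_eq_mul X]
  rw [sum_restrict_restrict_compl X fun u r => (if (fun y : {y // y ∉ X} => s y) = r then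
    B (fun x => s x) u else 0) * (prodState (fun x : X => w x) u *
      prodState (fun y : {y // y ∉ X} => w y) r)]
  simp [Finset.sum_mul, mul_assoc]

theorem inner_prodState_localOp (X : Finset Λ) (B : Matrix (X → Fin d) (X → Fin d) ℂ)
    (v w : Λ → Site d) :
    ⟪prodState v, (localOp X B).toEuclideanLin (prodState w)⟫_ℂ =
      ⟪prodState fun x : X => v x, B.toEuclideanLin (prodState fun x : X => w x)⟫_ℂ *
        ∏ y : {y // y ∉ X}, ⟪v y, w y⟫_ℂ := by
  rw [← inner_prodState (fun y : {y // y ∉ X} => v y) fun y => w y]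
  simp only [PiLp.inner_apply, localOp_prodState_apply, prodState_apply_eq_mul X v,
    Finset.sum_mul_sum]
  rw [← sum_restrict_restrict_compl X]
  simp only [RCLike.inner_apply, map_mul]
  exact Finset.sum_congr rfl fun s _ => by ring

end Support

section Permutations

variable {Λ : Type} [Fintype Λ] {d : ℕ}

/-- Permutation of the sites as an operator: the matrix of `permState σ`. -/
def permOp (d : ℕ) (σ : Equiv.Perm Λ) : Op Λ d :=
  Equiv.Perm.permMatrix ℂ (σ.arrowCongr (Equiv.refl (Fin d)))

theorem permOp_apply (σ : Equiv.Perm Λ) (s t : Λ → Fin d) :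
    permOp d σ s t = if (fun x => s (σ.symm x)) = t then 1 else 0 := by
  simp only [permOp, Equiv.Perm.permMatrix, PEquiv.toMatrix_apply, Equiv.toPEquiv_apply,
    Option.mem_some_iff]
  rfl

theorem permOp_one : permOp d (1 : Equiv.Perm Λ) = 1 :=
  Matrix.permMatrix_one

theorem star_permOp (σ : Equiv.Perm Λ) : star (permOp d σ) = permOp d σ⁻¹ :=
  Matrix.conjTranspose_permMatrix (σ.arrowCongr (Equiv.refl (Fin d)))

theorem permState_prodState (σ : Equiv.Perm Λ) (v : Λ → Site d) :
    permState σ (prodState v) = prodState fun x => v (σ x) := by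
  ext s
  simp only [permState, prodState]
  rw [← Equiv.prod_comp σ]
  simp

theorem permState_permState (σ τ : Equiv.Perm Λ) (ψ : ManyBody Λ d) :
    permState σ (permState τ ψ) = permState (τ * σ) ψ := rfl

variable [DecidableEq Λ]

theorem permOp_toEuclideanLin (σ : Equiv.Perm Λ) (ψ : ManyBody Λ d) :
    (permOp d σ).toEuclideanLin ψ = permState σ ψ := by
  ext s
  rw [Matrix.ofLp_toLpLin, Matrix.toLin'_apply, permOp, Matrix.permMatrix_mulVec]
  rfl

theorem permOp_mul_permOp (σ τ : Equiv.Perm Λ) : permOp d σ * permOp d τ = permOp d (τ * σ) :=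
  (Matrix.permMatrix_mul _ _).symm

theorem localOp_permOp (X : Finset Λ) (σ : Equiv.Perm X) :
    localOp X (permOp d σ) = permOp d (Equiv.Perm.ofSubtype σ) := by
  ext s t
  have hst : (fun x => s ((Equiv.Perm.ofSubtype σ).symm x)) = t ↔
      (∀ y ∉ X, s y = t y) ∧ (fun x : X => s (σ.symm x)) = fun x : X => t x := by
    have hin (x : X) : (Equiv.Perm.ofSubtype σ).symm x = σ.symm x :=
      Equiv.Perm.ofSubtype_apply_coe σ⁻¹ x
    have hout {y : Λ} (hy : y ∉ X) : (Equiv.Perm.ofSubtype σ).symm y = y :=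
      Equiv.Perm.ofSubtype_apply_of_not_mem σ⁻¹ hy
    constructor
    · rintro rfl
      exact ⟨fun y hy => congrArg s (hout hy).symm, funext fun x => congrArg s (hin x).symm⟩
    · rintro ⟨hoff, hon⟩
      ext1 y
      by_cases hy : y ∈ X
      · exact (congrArg s (hin ⟨y, hy⟩)).trans (congrFun hon ⟨y, hy⟩)
      · rw [hout hy, hoff y hy]
  simp only [localOp, permOp_apply, hst, ite_and]

end Permutations

section Annihilators

variable {Λ : Type} [Fintype Λ] [DecidableEq Λ] {d : ℕ}

/-- The orthogonal projector onto `W` as a matrix. -/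
noncomputable def projMatrix (W : Submodule ℂ (Site d)) : Matrix (Fin d) (Fin d) ℂ :=
  Matrix.toEuclideanLin.symm W.starProjection

theorem projMatrix_toEuclideanLin (W : Submodule ℂ (Site d)) :
    (projMatrix W).toEuclideanLin = W.starProjection :=
  Matrix.toEuclideanLin.apply_symm_apply _

theorem isStarProjection_projMatrix (W : Submodule ℂ (Site d)) :
    IsStarProjection (projMatrix W) where
  isIdempotentElem := Matrix.toEuclideanLin.injective <| by
    rw [Matrix.toLpLin_mul_same, projMatrix_toEuclideanLin]
    exact LinearMap.ext fun v => DFunLike.congr_fun W.isIdempotentElem_starProjection.eq v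
  isSelfAdjoint := Matrix.isSymmetric_toEuclideanLin_iff.1 <| by
    rw [projMatrix_toEuclideanLin]
    exact W.starProjection_isSymmetric

/-- The one-site projector `1 - P_W` at the site `x`, where `P_W` is the orthogonal projector
onto `W`. -/
noncomputable def siteAnnihilator (W : Submodule ℂ (Site d)) (x : Λ) : Op Λ d :=
  1 - siteOp x (projMatrix W)

/-- The projector `(1 - Π_{xy}) / 2` onto the states antisymmetric under the exchange of the
sites `x` and `y`. -/
noncomputable def exchangeAnnihilator (d : ℕ) (x y : Λ) : Op Λ d :=
  (2⁻¹ : ℂ) • (1 - permOp d (Equiv.swap x y))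

/-- `exchangeAnnihilator` as a function of the unordered pair of sites. -/
noncomputable def edgeAnnihilator (d : ℕ) : Sym2 Λ → Op Λ d :=
  Sym2.lift ⟨exchangeAnnihilator d, fun x y => by
    rw [exchangeAnnihilator, exchangeAnnihilator, Equiv.swap_comm]⟩

theorem isStarProjection_siteAnnihilator (W : Submodule ℂ (Site d)) (x : Λ) :
    IsStarProjection (siteAnnihilator W x) :=
  (isStarProjection_siteOp x (isStarProjection_projMatrix W)).one_sub

theorem siteAnnihilator_eq_zero_iff {W : Submodule ℂ (Site d)} {x : Λ} {ψ : ManyBody Λ d} :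
    (siteAnnihilator W x).toEuclideanLin ψ = 0 ↔
      (siteOp x (projMatrix W)).toEuclideanLin ψ = ψ := by
  rw [siteAnnihilator, map_sub, LinearMap.sub_apply, sub_eq_zero, eq_comm, Matrix.toLpLin_one,
    LinearMap.id_apply]

theorem exchangeAnnihilator_eq_zero_iff {x y : Λ} {ψ : ManyBody Λ d} :
    (exchangeAnnihilator d x y).toEuclideanLin ψ = 0 ↔ permState (Equiv.swap x y) ψ = ψ := by
  rw [exchangeAnnihilator, map_smul, LinearMap.smul_apply, smul_eq_zero_iff_right (by norm_num),
    map_sub, LinearMap.sub_apply, sub_eq_zero, eq_comm, Matrix.toLpLin_one, LinearMap.id_apply,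
    permOp_toEuclideanLin]

theorem siteAnnihilator_eq_zero_of_mem_tensorPower {W : Submodule ℂ (Site d)} (x : Λ)
    {ψ : ManyBody Λ d} (hψ : ψ ∈ tensorPower Λ W) :
    (siteAnnihilator W x).toEuclideanLin ψ = 0 := by
  refine Submodule.span_le (p := (siteAnnihilator W x).toEuclideanLin.ker).2 ?_ hψ
  rintro _ ⟨v, hv, rfl⟩
  refine siteAnnihilator_eq_zero_iff.2
    ((siteOp_prodState_of_eigen (μ := 1) ?_).trans (one_smul _ _))
  rw [projMatrix_toEuclideanLin, ContinuousLinearMap.coe_coe,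
    Submodule.starProjection_eq_self_iff.2 (hv x), one_smul]

theorem isLocalAnnihilator_siteAnnihilator (W : Submodule ℂ (Site d)) (x : Λ) :
    IsLocalAnnihilator W {x} (siteAnnihilator W x) where
  isStarProjection := isStarProjection_siteAnnihilator W x
  supported := (SupportedOn.one {x}).sub (supportedOn_siteOp x _)
  annihilates _ hψ := siteAnnihilator_eq_zero_of_mem_tensorPower x hψ.1

theorem isLocalAnnihilator_exchangeAnnihilator (W : Submodule ℂ (Site d)) (x y : Λ) :
    IsLocalAnnihilator W {x, y} (exchangeAnnihilator d x y) where
  isStarProjection := isStarProjection_half_smul_one_sub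
    (by rw [IsSelfAdjoint, star_permOp, Equiv.swap_inv])
    (by rw [permOp_mul_permOp, Equiv.swap_mul_self, permOp_one])
  supported := by
    refine .smul _ ((SupportedOn.one _).sub ⟨permOp d (Equiv.swap ⟨x, by simp⟩ ⟨y, by simp⟩), ?_⟩)
    rw [localOp_permOp, Equiv.Perm.ofSubtype_swap_eq]
  annihilates _ hψ := exchangeAnnihilator_eq_zero_iff.2 (hψ.2 _)

theorem isLocalAnnihilator_edgeAnnihilator (W : Submodule ℂ (Site d)) (e : Sym2 Λ) :
    IsLocalAnnihilator W e.toFinset (edgeAnnihilator d e) := by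
  induction e with
  | _ x y =>
    rw [Sym2.toFinset_mk_eq]
    exact isLocalAnnihilator_exchangeAnnihilator W x y

end Annihilators

section JointKernel

theorem submonoid_eq_top_of_adj_swap_mem {Λ : Type*} [Finite Λ] [DecidableEq Λ]
    {G : SimpleGraph Λ} (hG : G.Connected) {S : Submonoid (Equiv.Perm Λ)}
    (hS : ∀ x y, G.Adj x y → Equiv.swap x y ∈ S) : S = ⊤ := by
  have hwalk : ∀ x y, Equiv.swap x y ∈ S := fun x y => by
    obtain ⟨p⟩ := hG x y
    induction p with
    | nil => rw [Equiv.swap_self]; exact S.one_mem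
    | cons hadj _ ih => exact SubmonoidClass.swap_mem_trans S (hS _ _ hadj) ih
  refine top_unique ((Equiv.Perm.mclosure_isSwap (α := Λ)).ge.trans (Submonoid.closure_le.2 ?_))
  rintro _ ⟨x, y, -, rfl⟩
  exact hwalk x y

variable {Λ : Type} [Fintype Λ] {d k : ℕ}

/-- The product weight state `⨂_x |m_{a x}⟩`. -/
noncomputable def basisState (C : CartanData d k) (a : Λ → Fin k) : ManyBody Λ d :=
  prodState fun x => C.vec (a x)

theorem tensorPower_target_le_span (C : CartanData d k) :
    tensorPower Λ C.target ≤ Submodule.span ℂ (Set.range (basisState (Λ := Λ) C)) := by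
  classical
  refine Submodule.span_le.2 ?_
  rintro _ ⟨v, hv, rfl⟩
  choose c hc using fun x => (Submodule.mem_span_range_iff_exists_fun ℂ).1 (hv x)
  rw [← funext hc, prodState_sum_smul]
  exact Submodule.sum_mem _ fun a _ =>
    Submodule.smul_mem _ _ (Submodule.subset_span (Set.mem_range_self a))

variable [DecidableEq Λ]

theorem permState_eq_of_forall_edgeAnnihilator {G : SimpleGraph Λ} (hG : G.Connected)
    {ψ : ManyBody Λ d} (hψ : ∀ e ∈ G.edgeSet, (edgeAnnihilator d e).toEuclideanLin ψ = 0)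
    (σ : Equiv.Perm Λ) : permState σ ψ = ψ := by
  let S : Submonoid (Equiv.Perm Λ) :=
    { carrier := {σ | permState σ ψ = ψ}
      one_mem' := rfl
      mul_mem' := fun {σ τ} hσ hτ => by
        rw [Set.mem_ofPred_eq, ← permState_permState, hσ, hτ] }
  have hS : S = ⊤ := submonoid_eq_top_of_adj_swap_mem hG fun x y hxy =>
    exchangeAnnihilator_eq_zero_iff.1 (hψ s(x, y) hxy)
  exact (hS ▸ Submonoid.mem_top σ : σ ∈ S)

theorem prodOp_apply_mem_tensorPower {W : Submodule ℂ (Site d)} {K : Matrix (Fin d) (Fin d) ℂ}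
    (hK : ∀ v, K.toEuclideanLin v ∈ W) (ψ : ManyBody Λ d) :
    (prodOp fun _ : Λ => K).toEuclideanLin ψ ∈ tensorPower Λ W := by
  rw [← (EuclideanSpace.basisFun _ ℂ).sum_repr ψ, map_sum]
  refine Submodule.sum_mem _ fun s _ => ?_
  rw [map_smul, EuclideanSpace.basisFun_apply, ← prodState_single, prodOp_prodState]
  exact Submodule.smul_mem _ _ (Submodule.subset_span ⟨_, fun _ => hK _, rfl⟩)

theorem mem_tensorPower_of_forall_siteAnnihilator {W : Submodule ℂ (Site d)} {ψ : ManyBody Λ d}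
    (hψ : ∀ x, (siteAnnihilator W x).toEuclideanLin ψ = 0) : ψ ∈ tensorPower Λ W := by
  let S : Submonoid (Op Λ d) :=
    { carrier := {A | A.toEuclideanLin ψ = ψ}
      one_mem' := by simp
      mul_mem' := fun {A B} hA hB => by
        rw [Set.mem_ofPred_eq, Matrix.toLpLin_mul_same, LinearMap.comp_apply, hB, hA] }
  have hS : (fun _ : Λ => projMatrix W) ∈ S.comap prodOp :=
    Submonoid.pi_mem_of_mulSingle_mem _ fun x => by
      rw [Submonoid.mem_comap, ← siteOp_eq_prodOp]
      exact siteAnnihilator_eq_zero_iff.1 (hψ x)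
  rw [← show _ = ψ from hS]
  refine prodOp_apply_mem_tensorPower (fun v => ?_) ψ
  rw [projMatrix_toEuclideanLin]
  exact W.starProjection_apply_mem v

theorem memSymPower_of_forall_annihilator {G : SimpleGraph Λ} (hG : G.Connected)
    {W : Submodule ℂ (Site d)} {ψ : ManyBody Λ d}
    (hsite : ∀ x, (siteAnnihilator W x).toEuclideanLin ψ = 0)
    (hedge : ∀ e ∈ G.edgeSet, (edgeAnnihilator d e).toEuclideanLin ψ = 0) : MemSymPower W ψ :=
  ⟨mem_tensorPower_of_forall_siteAnnihilator hsite,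
    permState_eq_of_forall_edgeAnnihilator hG hedge⟩

theorem weightState_eq_sum_permOp (C : CartanData d k) (a : Λ → Fin k) :
    weightState C a = (∑ σ : Equiv.Perm Λ, permOp d σ).toEuclideanLin (basisState C a) := by
  rw [map_sum, LinearMap.sum_apply]
  simp only [permOp_toEuclideanLin]
  rfl

theorem MemSymPower.mem_span_weightState {C : CartanData d k} {ψ : ManyBody Λ d}
    (hψ : MemSymPower C.target ψ) :
    ψ ∈ Submodule.span ℂ (Set.range (weightState (Λ := Λ) C)) := by
  have hfix : (∑ σ : Equiv.Perm Λ, permOp d σ).toEuclideanLin ψ =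
      (Fintype.card (Equiv.Perm Λ) : ℂ) • ψ := by
    rw [map_sum, LinearMap.sum_apply]
    simp [permOp_toEuclideanLin, hψ.2, Nat.cast_smul_eq_nsmul]
  have hcard : (Fintype.card (Equiv.Perm Λ) : ℂ) ≠ 0 := Nat.cast_ne_zero.2 Fintype.card_ne_zero
  rw [← Submodule.smul_mem_iff _ hcard, ← hfix]
  have := Submodule.mem_map_of_mem (f := (∑ σ : Equiv.Perm Λ, permOp d σ).toEuclideanLin)
    (tensorPower_target_le_span C hψ.1)
  rw [Submodule.map_span, ← Set.range_comp] at this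
  rwa [show weightState C = _ from funext (weightState_eq_sum_permOp (Λ := Λ) C)]

theorem exists_eq_sum_mul_annihilator {G : SimpleGraph Λ} [DecidableRel G.Adj] (hG : G.Connected)
    {C : CartanData d k} {A : Op Λ d}
    (hA : ∀ a, A.toEuclideanLin (weightState C a) = 0) :
    ∃ (h₁ : Λ → Op Λ d) (h₂ : Sym2 Λ → Op Λ d),
      A = ∑ x, h₁ x * siteAnnihilator C.target x +
        ∑ e ∈ G.edgeFinset, h₂ e * edgeAnnihilator d e := by
  have hspan : Submodule.span ℂ (Set.range (weightState (Λ := Λ) C)) ≤ A.toEuclideanLin.ker :=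
    Submodule.span_le.2 (Set.range_subset_iff.2 hA)
  obtain ⟨B, hB⟩ := exists_eq_sum_mul_of_mulVec_eq_zero (A := A)
    (s := Finset.univ.disjSum G.edgeFinset)
    (P := Sum.elim (siteAnnihilator C.target) (edgeAnnihilator d)) fun v hv => by
      have hsym : MemSymPower C.target (WithLp.toLp 2 v) :=
        memSymPower_of_forall_annihilator hG
          (fun x => congrArg (WithLp.toLp 2) (hv (.inl x) (by simp)))
          (fun e he => congrArg (WithLp.toLp 2) (hv (.inr e) (by simpa using he)))
      exact congrArg WithLp.ofLp (hspan hsym.mem_span_weightState)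
  exact ⟨B ∘ Sum.inl, B ∘ Sum.inr, by simpa [Finset.sum_disjSum] using hB⟩

end JointKernel

section NonInteracting

open Function

variable {Λ ι M : Type*} [DecidableEq Λ] [AddCommGroup M]

/-- The sites `x` and `y` do not interact in the energy function `E`: the energy cost of changing
the value at one of them does not depend on the value at the other. -/
def NonInteracting (E : (Λ → ι) → M) (x y : Λ) : Prop :=
  ∀ a i j, E (update (update a x i) y j) + E a = E (update a x i) + E (update a y j)

theorem nonInteracting_of_update_left {E : (Λ → ι) → M} {x y : Λ} (hxy : x ≠ y)
    (hE : ∀ a i, E (update a x i) = E a) : NonInteracting E x y := fun a i j => by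
  rw [update_comm hxy, hE, hE, add_comm]

theorem nonInteracting_of_update_right {E : (Λ → ι) → M} {x y : Λ}
    (hE : ∀ a j, E (update a y j) = E a) : NonInteracting E x y := fun a i j => by
  rw [hE, hE]

theorem NonInteracting.sum {κ : Type*} {s : Finset κ} {E : κ → (Λ → ι) → M} {x y : Λ}
    (hE : ∀ n ∈ s, NonInteracting (E n) x y) : NonInteracting (∑ n ∈ s, E n) x y := fun a i j => by
  simp only [Finset.sum_apply, ← Finset.sum_add_distrib]
  exact Finset.sum_congr rfl fun n hn => hE n hn a i j

theorem NonInteracting.map_perm {E : (Λ → ι) → M} {x y : Λ} (h : NonInteracting E x y)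
    (hE : ∀ a (σ : Equiv.Perm Λ), E (a ∘ σ) = E a) (σ : Equiv.Perm Λ) :
    NonInteracting E (σ x) (σ y) := fun a i j => by
  have hcomp (b : Λ → ι) (z : Λ) (l : ι) : E (update b (σ z) l) = E (update (b ∘ σ) z l) := by
    rw [← hE, update_comp_eq_of_injective b σ.injective]
  rw [hcomp, hcomp, hcomp, update_comp_eq_of_injective a σ.injective, ← hE a σ]
  exact h (a ∘ σ) i j

theorem NonInteracting.forall_ne {E : (Λ → ι) → M} {x y : Λ} (h : NonInteracting E x y)
    (hxy : x ≠ y) (hE : ∀ a (σ : Equiv.Perm Λ), E (a ∘ σ) = E a) {x' y' : Λ} (hxy' : x' ≠ y') :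
    NonInteracting E x' y' := by
  obtain ⟨σ, rfl, rfl⟩ := MulAction.is_two_pretransitive_iff.1
    (Equiv.Perm.isMultiplyPretransitive Λ 2) hxy hxy'
  exact h.map_perm hE σ

theorem update_piecewise_sub_of_nonInteracting {E : (Λ → ι) → M}
    (hE : ∀ x y, x ≠ y → NonInteracting E x y) (a c : Λ → ι) {S : Finset Λ} {x : Λ} (hx : x ∉ S)
    (i : ι) :
    E (update (S.piecewise a c) x i) - E (S.piecewise a c) = E (update c x i) - E c := by
  induction S using Finset.induction_on with
  | empty => rw [Finset.piecewise_empty]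
  | insert y S _ ih =>
    rw [Finset.mem_insert, not_or] at hx
    rw [← ih hx.2, Finset.piecewise_insert, sub_eq_sub_iff_add_eq_add,
      hE y x (Ne.symm hx.1), add_comm]

theorem eq_add_sum_of_nonInteracting [Fintype Λ] {E : (Λ → ι) → M}
    (hE : ∀ x y, x ≠ y → NonInteracting E x y) (a c : Λ → ι) :
    E a = E c + ∑ x, (E (update c x (a x)) - E c) := by
  have hS (S : Finset Λ) :
      E (S.piecewise a c) = E c + ∑ x ∈ S, (E (update c x (a x)) - E c) := by
    induction S using Finset.induction_on with
    | empty => simp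
    | insert x S hx ih =>
      rw [Finset.sum_insert hx, ← update_piecewise_sub_of_nonInteracting hE a c hx,
        Finset.piecewise_insert, add_left_comm, ← ih, sub_add_cancel]
  simpa only [Finset.piecewise_univ] using hS Finset.univ

theorem card_nsmul_eq_sum_of_nonInteracting [Fintype Λ] {E : (Λ → ι) → M}
    (hE : ∀ x y, x ≠ y → NonInteracting E x y)
    (hsymm : ∀ a (σ : Equiv.Perm Λ), E (a ∘ σ) = E a) (a : Λ → ι) :
    Fintype.card Λ • E a = ∑ x, E fun _ => a x := by
  rcases isEmpty_or_nonempty Λ with hΛ | ⟨⟨x₀⟩⟩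
  · simp
  set c : Λ → ι := fun _ => a x₀
  have hsite (x : Λ) (i : ι) : E (update c x i) = E (update c x₀ i) := by
    have hswap := update_comp_eq_of_injective c (Equiv.swap x₀ x).injective x₀ i
    rw [Equiv.swap_apply_left] at hswap
    rw [← hsymm _ (Equiv.swap x₀ x), hswap]
    rfl
  have hexpand (b : Λ → ι) : E b = E c + ∑ x, (E (update c x₀ (b x)) - E c) := by
    simpa only [hsite] using eq_add_sum_of_nonInteracting hE b c
  rw [hexpand a, Finset.sum_congr rfl fun x _ => hexpand fun _ => a x]
  simp only [Finset.sum_const, Finset.card_univ, Finset.sum_add_distrib, smul_add,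
    Finset.smul_sum]

end NonInteracting

section OrbitEnergy

variable {Λ : Type} [Fintype Λ] [DecidableEq Λ]

section Rearrangements

variable {ι : Type*} [Fintype ι] [DecidableEq ι]

/-- The configurations in which every value is taken on as many sites as in `a`. -/
def rearrangements (a : Λ → ι) : Finset (Λ → ι) :=
  {b | Finset.univ.val.map b = Finset.univ.val.map a}

theorem mem_rearrangements {a b : Λ → ι} :
    b ∈ rearrangements a ↔ Finset.univ.val.map b = Finset.univ.val.map a := by
  simp [rearrangements]

theorem self_mem_rearrangements (a : Λ → ι) : a ∈ rearrangements a :=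
  mem_rearrangements.2 rfl

theorem mem_rearrangements_iff_exists_perm {a b : Λ → ι} :
    b ∈ rearrangements a ↔ ∃ σ : Equiv.Perm Λ, a ∘ σ = b := by
  rw [mem_rearrangements]
  constructor
  · intro hab
    have hcard (i : ι) : Fintype.card {x // b x = i} = Fintype.card {x // a x = i} := by
      simpa [Multiset.count_map, Fintype.card_subtype, eq_comm, Finset.card_def] using
        congrArg (Multiset.count i) hab
    let σ : Equiv.Perm Λ := Equiv.ofFiberEquiv fun i => Fintype.equivOfCardEq (hcard i)
    exact ⟨σ, funext fun x => Equiv.ofFiberEquiv_map _ x⟩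
  · rintro ⟨σ, rfl⟩
    rw [← Multiset.map_map, Multiset.map_univ_val_equiv]

theorem mem_rearrangements_iff_of_eq_off {X : Finset Λ} {a b : Λ → ι}
    (hab : (fun y : {y // y ∉ X} => b y) = fun y : {y // y ∉ X} => a y) :
    b ∈ rearrangements a ↔ (fun x : X => b x) ∈ rearrangements fun x : X => a x := by
  have hsplit (c : Λ → ι) : Finset.univ.val.map c =
      Finset.univ.val.map (fun x : X => c x) +
        Finset.univ.val.map fun y : {y // y ∉ X} => c y := by
    have hon := Finset.univ_val_map_subtype_restrict c (· ∈ X)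
    have hoff := Finset.univ_val_map_subtype_restrict c (· ∉ X)
    rw [Subtype.restrict_def] at hon hoff
    rw [← Multiset.filter_add_not (· ∈ X) Finset.univ.val, Multiset.map_add]
    refine congrArg₂ (· + ·) ?_ hoff.symm
    convert hon.symm <;> rfl
  rw [mem_rearrangements, mem_rearrangements, hsplit a, hsplit b, hab, add_left_inj]

theorem sum_rearrangements_eq_off {M : Type*} [AddCommMonoid M] (X : Finset Λ) (a : Λ → ι)
    (f : (X → ι) → M) :
    (∑ b ∈ rearrangements a,
      if (fun y : {y // y ∉ X} => a y) = fun y : {y // y ∉ X} => b y then f fun x => b x else 0) =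
      ∑ u ∈ rearrangements fun x : X => a x, f u := by
  calc _ = ∑ b : Λ → ι, if (fun y : {y // y ∉ X} => a y) = fun y : {y // y ∉ X} => b y then
          if (fun x : X => b x) ∈ rearrangements fun x : X => a x then f fun x => b x else 0
          else 0 := by
        rw [← Finset.univ_inter (rearrangements a), ← Finset.sum_ite_mem]
        refine Finset.sum_congr rfl fun b _ => ?_
        by_cases hab : (fun y : {y // y ∉ X} => a y) = fun y : {y // y ∉ X} => b y
        · simp only [if_pos hab, mem_rearrangements_iff_of_eq_off hab.symm]
        · simp only [if_neg hab, ite_self]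
    _ = ∑ u : X → ι, ∑ r : {y // y ∉ X} → ι, if (fun y : {y // y ∉ X} => a y) = r then
          if u ∈ rearrangements fun x : X => a x then f u else 0 else 0 :=
        sum_restrict_restrict_compl X fun u r => if (fun y : {y // y ∉ X} => a y) = r then
          if u ∈ rearrangements fun x : X => a x then f u else 0 else 0
    _ = _ := by simp only [Finset.sum_ite_eq, Finset.mem_univ, if_true, Finset.sum_ite_mem,
        Finset.univ_inter]

theorem sum_perm_comp {M : Type*} [AddCommMonoid M] (a : Λ → ι) (f : (Λ → ι) → M) :
    ∑ σ : Equiv.Perm Λ, f (a ∘ σ) =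
      #{σ : Equiv.Perm Λ | a ∘ σ = a} • ∑ b ∈ rearrangements a, f b := by
  have himage : Finset.univ.image (fun σ : Equiv.Perm Λ => a ∘ σ) = rearrangements a := by
    ext b
    simp [mem_rearrangements_iff_exists_perm]
  rw [Finset.sum_comp f fun σ : Equiv.Perm Λ => a ∘ σ, himage, Finset.smul_sum]
  refine Finset.sum_congr rfl fun b hb => ?_
  obtain ⟨τ, rfl⟩ := mem_rearrangements_iff_exists_perm.1 hb
  congr 1
  refine Finset.card_equiv (Equiv.mulRight τ⁻¹) fun σ => ?_
  simp [funext_iff, ← τ.forall_congr_right (q := fun x => a (σ (τ.symm x)) = a x)]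

end Rearrangements

variable {d k : ℕ}

theorem inner_basisState (C : CartanData d k) (a b : Λ → Fin k) :
    ⟪basisState C a, basisState C b⟫_ℂ = if a = b then 1 else 0 := by
  simp [basisState, inner_prodState, orthonormal_iff_ite.1 C.orthonormal_vec,
    Finset.prod_ite_zero, funext_iff]

theorem weightState_eq_smul_sum (C : CartanData d k) (a : Λ → Fin k) :
    weightState C a =
      #{σ : Equiv.Perm Λ | a ∘ σ = a} • ∑ b ∈ rearrangements a, basisState C b := by
  rw [← sum_perm_comp]
  simp only [weightState, permState_prodState]
  rfl

theorem inner_basisState_weightState (C : CartanData d k) (a : Λ → Fin k) :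
    ⟪basisState C a, weightState C a⟫_ℂ = #{σ : Equiv.Perm Λ | a ∘ σ = a} := by
  simp [weightState_eq_smul_sum, ← Nat.cast_smul_eq_nsmul ℂ, inner_basisState,
    self_mem_rearrangements]

theorem card_stabilizer_ne_zero (a : Λ → Fin k) : (#{σ : Equiv.Perm Λ | a ∘ σ = a} : ℂ) ≠ 0 :=
  Nat.cast_ne_zero.2 (Finset.card_ne_zero_of_mem (a := 1) (by simp))

theorem weightState_ne_zero (C : CartanData d k) (a : Λ → Fin k) : weightState C a ≠ 0 := by
  intro h
  have := inner_basisState_weightState C a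
  rw [h, inner_zero_right] at this
  exact card_stabilizer_ne_zero a this.symm

/-- The sum of the matrix elements of `A` between `basisState C a` and its rearrangements, which is
the eigenvalue of `A` if `weightState C a` is an eigenvector. -/
noncomputable def orbitEnergy (C : CartanData d k) (A : Op Λ d) (a : Λ → Fin k) : ℂ :=
  ∑ b ∈ rearrangements a, ⟪basisState C a, A.toEuclideanLin (basisState C b)⟫_ℂ

theorem orbitEnergy_eq_of_eigen {C : CartanData d k} {A : Op Λ d} {a : Λ → Fin k} {E : ℂ}
    (h : A.toEuclideanLin (weightState C a) = E • weightState C a) : orbitEnergy C A a = E := by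
  have := congrArg (fun ψ => ⟪basisState C a, ψ⟫_ℂ) h
  simp only [inner_smul_right, inner_basisState_weightState] at this
  rw [weightState_eq_smul_sum, map_nsmul, map_sum, ← Nat.cast_smul_eq_nsmul ℂ,
    inner_smul_right, inner_sum, mul_comm] at this
  exact mul_right_cancel₀ (card_stabilizer_ne_zero a) this

theorem orbitEnergy_sum {κ : Type*} (C : CartanData d k) (s : Finset κ) (A : κ → Op Λ d) :
    orbitEnergy C (∑ i ∈ s, A i) = ∑ i ∈ s, orbitEnergy C (A i) := by
  ext a
  simp only [orbitEnergy, map_sum, LinearMap.sum_apply, inner_sum, Finset.sum_apply]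
  exact Finset.sum_comm

theorem inner_basisState_localOp (C : CartanData d k) (X : Finset Λ)
    (B : Matrix (X → Fin d) (X → Fin d) ℂ) (a b : Λ → Fin k) :
    ⟪basisState C a, (localOp X B).toEuclideanLin (basisState C b)⟫_ℂ =
      if (fun y : {y // y ∉ X} => a y) = fun y : {y // y ∉ X} => b y then
        ⟪basisState C fun x : X => a x, B.toEuclideanLin (basisState C fun x : X => b x)⟫_ℂ
      else 0 := by
  rw [basisState, basisState, inner_prodState_localOp, ← inner_prodState]
  exact (congrArg _ (inner_basisState C _ _)).trans (mul_boole _ _)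

theorem orbitEnergy_localOp (C : CartanData d k) (X : Finset Λ)
    (B : Matrix (X → Fin d) (X → Fin d) ℂ) (a : Λ → Fin k) :
    orbitEnergy C (localOp X B) a = orbitEnergy C B fun x : X => a x := by
  simp only [orbitEnergy, inner_basisState_localOp]
  exact sum_rearrangements_eq_off X a fun u =>
    ⟪basisState C fun x : X => a x, B.toEuclideanLin (basisState C u)⟫_ℂ

theorem SupportedOn.orbitEnergy_update {X : Finset Λ} {A : Op Λ d} (hA : SupportedOn X A)
    (C : CartanData d k) {x : Λ} (hx : x ∉ X) (a : Λ → Fin k) (i : Fin k) :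
    orbitEnergy C A (Function.update a x i) = orbitEnergy C A a := by
  obtain ⟨B, rfl⟩ := hA
  have hres : (fun z : X => Function.update a x i z) = fun z : X => a z :=
    funext fun z => Function.update_of_ne (ne_of_mem_of_not_mem z.2 hx) i a
  rw [orbitEnergy_localOp, orbitEnergy_localOp, hres]

theorem nonInteracting_orbitEnergy_sum (C : CartanData d k) {h : Finset Λ → Op Λ d}
    (hsupp : ∀ X, SupportedOn X (h X)) {x y : Λ} (hxy : x ≠ y)
    (huncoupled : ∀ X, h X ≠ 0 → x ∈ X → y ∉ X) :
    NonInteracting (orbitEnergy C (∑ X, h X)) x y := by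
  rw [orbitEnergy_sum]
  refine NonInteracting.sum fun X _ => ?_
  by_cases hx : x ∈ X
  · by_cases hy : y ∈ X
    · have hX : h X = 0 := by_contra fun hX => huncoupled X hX hx hy
      refine nonInteracting_of_update_right fun a j => ?_
      simp [orbitEnergy, hX]
    · exact nonInteracting_of_update_right ((hsupp X).orbitEnergy_update C hy)
  · exact nonInteracting_of_update_left hxy ((hsupp X).orbitEnergy_update C hx)

end OrbitEnergy

section Cartan

open InnerProductSpace

variable {d k : ℕ}

theorem CartanData.linearMap_ext (C : CartanData d k) {T T' : Site d →ₗ[ℂ] Site d}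
    (hvec : ∀ j, T (C.vec j) = T' (C.vec j)) (horth : ∀ v ∈ C.targetᗮ, T v = T' v) : T = T' := by
  rw [← LinearMap.eqLocus_eq_top, eq_top_iff,
    ← Submodule.sup_orthogonal_of_hasOrthogonalProjection (K := C.target)]
  exact sup_le (Submodule.span_le.2 (Set.range_subset_iff.2 hvec)) horth

theorem CartanData.toEuclideanLin_gen (C : CartanData d k) (i : Fin (k - 1)) :
    (C.gen i).toEuclideanLin =
      ∑ j, (C.weight j i : ℂ) • (rankOne ℂ (C.vec j) (C.vec j)).toLinearMap := by
  refine C.linearMap_ext (fun j => ?_) fun v hv => ?_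
  · simp [C.gen_vec, orthonormal_iff_ite.1 C.orthonormal_vec]
  · have hinner (j : Fin k) : ⟪C.vec j, v⟫_ℂ = 0 :=
      hv _ (Submodule.subset_span (Set.mem_range_self j))
    simp [C.gen_orthogonal i v hv, hinner]

theorem CartanData.sum_weight (C : CartanData d k) (i : Fin (k - 1)) :
    ∑ j, (C.weight j i : ℂ) = 0 := by
  have := congrArg (LinearMap.trace ℂ (Site d)) (C.toEuclideanLin_gen i)
  rw [Matrix.toEuclideanLin_eq_toLin_orthonormal, Matrix.trace_toLin_eq, C.trace_gen] at this
  simpa [trace_rankOne, inner_self_eq_norm_sq_to_K, C.orthonormal_vec.1] using this.symm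

/-- The diagonal elements, on the weight states, of `∑ i, g i • gen i + c • 1` as a function of
`(g, c)`. -/
noncomputable def CartanData.diagonal (C : CartanData d k) :
    ((Fin (k - 1) → ℂ) × ℂ) →ₗ[ℂ] (Fin k → ℂ) :=
  .coprod (Matrix.of fun j i => (C.weight j i : ℂ)).mulVecLin (.toSpanSingleton ℂ _ 1)

theorem CartanData.diagonal_apply (C : CartanData d k) (g : Fin (k - 1) → ℂ) (c : ℂ) (j : Fin k) :
    C.diagonal (g, c) j = ∑ i, g i * C.weight j i + c := by
  simp [diagonal, mulVec, dotProduct, mul_comm]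

theorem CartanData.diagonal_injective (C : CartanData d k) (hk : k ≠ 0) :
    Function.Injective C.diagonal := by
  refine (injective_iff_map_eq_zero _).2 fun ⟨g, c⟩ h => ?_
  replace h (j : Fin k) : ∑ i, g i * C.weight j i + c = 0 :=
    (C.diagonal_apply g c j).symm.trans (congrFun h j)
  have hc : k * c = 0 := by
    simpa [Finset.sum_add_distrib, Finset.sum_comm (γ := Fin k), ← Finset.mul_sum, C.sum_weight]
      using Finset.sum_congr rfl fun j (_ : j ∈ Finset.univ) => h j
  obtain rfl : c = 0 := by simpa [hk] using hc
  have hg : ∑ i, g i • C.gen i = 0 := by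
    refine Matrix.toEuclideanLin.injective (C.linearMap_ext (fun j => ?_) fun v hv => ?_)
    · have hj : ∑ i, g i * (C.weight j i : ℂ) = 0 := by simpa using h j
      simp only [map_sum, map_smul, LinearMap.sum_apply, LinearMap.smul_apply, C.gen_vec,
        smul_smul, ← Finset.sum_smul, hj, zero_smul, map_zero, LinearMap.zero_apply]
    · simp [C.gen_orthogonal _ v hv]
  exact Prod.ext (funext (Fintype.linearIndependent_iff.1 C.linearIndependent_gen g hg)) rfl

theorem CartanData.diagonal_surjective (C : CartanData d k) (hk : k ≠ 0) :
    Function.Surjective C.diagonal :=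
  (LinearMap.injective_iff_surjective_of_finrank_eq_finrank <| by
    simp only [Module.finrank_prod, Module.finrank_fin_fun, Module.finrank_self]
    lia).1 (C.diagonal_injective hk)

theorem CartanData.exists_eq_diagonal (C : CartanData d k) (f : Fin k → ℂ) :
    ∃ (g : Fin (k - 1) → ℂ) (c : ℂ), (∀ j, f j = ∑ i, g i * C.weight j i + c) ∧
      ((∀ j, (f j).im = 0) → (∀ i, (g i).im = 0) ∧ c.im = 0) := by
  rcases eq_or_ne k 0 with rfl | hk
  · exact ⟨0, 0, fun j => j.elim0, by simp⟩
  obtain ⟨⟨g, c⟩, rfl⟩ := C.diagonal_surjective hk f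
  refine ⟨g, c, C.diagonal_apply g c, fun him => ?_⟩
  have hzero : C.diagonal (fun i => ((g i).im : ℂ), (c.im : ℂ)) = 0 := by
    ext j
    have := him j
    rw [C.diagonal_apply, Pi.zero_apply] at *
    rw [Complex.add_im, Complex.im_sum] at this
    simp only [Complex.im_mul_ofReal] at this
    exact_mod_cast this
  have := C.diagonal_injective hk (hzero.trans (map_zero _).symm)
  rw [Prod.mk_eq_zero, funext_iff] at this
  simpa using this

end Cartan

section Spectrum

variable {Λ : Type} [Fintype Λ] [DecidableEq Λ] {d k : ℕ}

theorem weightState_comp (C : CartanData d k) (a : Λ → Fin k) (τ : Equiv.Perm Λ) :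
    weightState C (a ∘ τ) = weightState C a := by
  simp only [weightState, permState_prodState]
  exact Equiv.sum_comp (Equiv.mulLeft τ) fun σ => basisState C (a ∘ σ)

theorem nonInteracting_eigenvalue {C : CartanData d k} {h : Finset Λ → Op Λ d}
    (hsupp : ∀ X, SupportedOn X (h X)) (hpair : ¬ AllToAll h) {E : (Λ → Fin k) → ℂ}
    (hE : ∀ a, (∑ X, h X).toEuclideanLin (weightState C a) = E a • weightState C a)
    (hsymm : ∀ a (σ : Equiv.Perm Λ), E (a ∘ σ) = E a) {x y : Λ} (hxy : x ≠ y) :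
    NonInteracting E x y := by
  have : Nontrivial Λ := ⟨x, y, hxy⟩
  obtain ⟨x₀, y₀, hne, huncoupled⟩ :
      ∃ x₀ y₀ : Λ, x₀ ≠ y₀ ∧ ∀ X, h X ≠ 0 → x₀ ∈ X → y₀ ∉ X := by
    simpa [AllToAll, this] using hpair
  have hEorbit : orbitEnergy C (∑ X, h X) = E := funext fun a => orbitEnergy_eq_of_eigen (hE a)
  have hni := nonInteracting_orbitEnergy_sum C hsupp hne huncoupled
  rw [hEorbit] at hni
  exact hni.forall_ne hne hsymm hxy

theorem exists_eigenvalue_eq_sum_weight [Nonempty Λ] {C : CartanData d k} {h : Finset Λ → Op Λ d}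
    (hsupp : ∀ X, SupportedOn X (h X)) (hpair : ¬ AllToAll h) {E : (Λ → Fin k) → ℂ}
    (hE : ∀ a, (∑ X, h X).toEuclideanLin (weightState C a) = E a • weightState C a) :
    ∃ (g : Fin (k - 1) → ℂ) (c : ℂ), (∀ a, E a = ∑ x, ∑ i, g i * C.weight (a x) i + c) ∧
      ((∀ a, (E a).im = 0) → (∀ i, (g i).im = 0) ∧ c.im = 0) := by
  have hsymm (a : Λ → Fin k) (σ : Equiv.Perm Λ) : E (a ∘ σ) = E a :=
    smul_left_injective ℂ (weightState_ne_zero C a) <| by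
      simpa only [← hE, weightState_comp] using (hE (a ∘ σ)).symm
  have hcard : (Fintype.card Λ : ℂ) ≠ 0 := Nat.cast_ne_zero.2 Fintype.card_ne_zero
  obtain ⟨g, c, hgc, hreal⟩ :=
    C.exists_eq_diagonal fun j => (Fintype.card Λ : ℂ)⁻¹ * E fun _ => j
  refine ⟨g, Fintype.card Λ * c, fun a => ?_, fun him => ?_⟩
  · have hsum := card_nsmul_eq_sum_of_nonInteracting
      (fun x y => nonInteracting_eigenvalue hsupp hpair hE hsymm) hsymm a
    calc E a = ∑ x, (Fintype.card Λ : ℂ)⁻¹ * E fun _ => a x := by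
          rw [← Finset.mul_sum, ← hsum, nsmul_eq_mul, inv_mul_cancel_left₀ hcard]
      _ = _ := by simp [hgc, Finset.sum_add_distrib]
  · have := hreal fun j => by simp [him]
    simpa [Complex.mul_im] using this

theorem sum_siteOp_gen_basisState (C : CartanData d k) (g : Fin (k - 1) → ℂ) (b : Λ → Fin k) :
    (∑ x : Λ, siteOp x (∑ i, g i • C.gen i)).toEuclideanLin (basisState C b) =
      (∑ x, ∑ i, g i * C.weight (b x) i) • basisState C b := by
  rw [map_sum, LinearMap.sum_apply, Finset.sum_smul]
  refine Finset.sum_congr rfl fun x _ => siteOp_prodState_of_eigen ?_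
  simp only [map_sum, map_smul, LinearMap.sum_apply, LinearMap.smul_apply, C.gen_vec, smul_smul,
    Finset.sum_smul]

theorem sum_siteOp_gen_weightState (C : CartanData d k) (g : Fin (k - 1) → ℂ) (a : Λ → Fin k) :
    (∑ x : Λ, siteOp x (∑ i, g i • C.gen i)).toEuclideanLin (weightState C a) =
      (∑ x, ∑ i, g i * C.weight (a x) i) • weightState C a := by
  rw [weightState, map_sum, Finset.smul_sum]
  refine Finset.sum_congr rfl fun σ _ => ?_
  rw [permState_prodState, ← Equiv.sum_comp σ fun x => ∑ i, g i * (C.weight (a x) i : ℂ)]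
  exact sum_siteOp_gen_basisState C g (a ∘ σ)

theorem im_eq_zero_of_isHermitian {A : Op Λ d} (hA : A.IsHermitian) {C : CartanData d k}
    {a : Λ → Fin k} {E : ℂ} (hE : A.toEuclideanLin (weightState C a) = E • weightState C a) :
    E.im = 0 :=
  Complex.conj_eq_iff_im.1 <|
    (Matrix.isSymmetric_toEuclideanLin_iff.2 hA).conj_eigenvalue_eq_self <|
      Module.End.hasEigenvalue_of_hasEigenvector
        ⟨Module.End.mem_eigenspace_iff.2 hE, weightState_ne_zero C a⟩

end Spectrum

end ScarStates

open ScarStates in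
theorem theorem6p1_general {Λ : Type} [Fintype Λ] [DecidableEq Λ] (G : SimpleGraph Λ)
    [DecidableRel G.Adj] (hG : G.Connected) {d k : ℕ} (C : CartanData d k)
    (h : Finset Λ → Op Λ d) (hsupp : ∀ X, SupportedOn X (h X)) (hpair : ¬ AllToAll h)
    (H : Op Λ d) (hH : H = ∑ X : Finset Λ, h X)
    (heig : ∀ a : Λ → Fin k, ∃ E : ℂ,
      H.toEuclideanLin (weightState C a) = E • weightState C a) :
    ∃ (h₁ P₁ : Λ → Op Λ d) (h₂ P₂ : Sym2 Λ → Op Λ d) (g : Fin (k - 1) → ℂ) (c : ℂ),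
      (∀ x, IsLocalAnnihilator C.target {x} (P₁ x)) ∧
      (∀ e ∈ G.edgeFinset, IsLocalAnnihilator C.target e.toFinset (P₂ e)) ∧
      H = ∑ x, h₁ x * P₁ x + ∑ e ∈ G.edgeFinset, h₂ e * P₂ e
          + ∑ x, siteOp x (∑ i, g i • C.gen i) + c • 1 ∧
      (H.IsHermitian → (∀ i, (g i).im = 0) ∧ c.im = 0) := by
  have : Nonempty Λ := hG.nonempty
  subst hH
  choose E hE using heig
  obtain ⟨g, c, hgc, hreal⟩ := exists_eigenvalue_eq_sum_weight hsupp hpair hE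
  have hkill (a : Λ → Fin k) : (∑ X, h X - (∑ x, siteOp x (∑ i, g i • C.gen i) + c • 1)
      : Op Λ d).toEuclideanLin (weightState C a) = 0 := by
    rw [map_sub, map_add, map_smul, LinearMap.sub_apply, LinearMap.add_apply, hE,
      sum_siteOp_gen_weightState, LinearMap.smul_apply, Matrix.toLpLin_one, LinearMap.id_apply,
      ← add_smul, ← hgc, sub_self]
  obtain ⟨h₁, h₂, hdecomp⟩ := exists_eq_sum_mul_annihilator hG hkill
  refine ⟨h₁, siteAnnihilator C.target, h₂, edgeAnnihilator d, g, c,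
    isLocalAnnihilator_siteAnnihilator _, fun e _ => isLocalAnnihilator_edgeAnnihilator _ e, ?_,
    fun hHerm => hreal fun a => im_eq_zero_of_isHermitian hHerm (hE a)⟩
  rw [add_assoc, ← hdecomp, sub_add_cancel]

open ScarStates in
theorem theorem6p1 {Λ : Type} [Fintype Λ] [DecidableEq Λ] (G : SimpleGraph Λ)
    [DecidableRel G.Adj] (hG : G.Connected) {d k : ℕ} (C : CartanData d k)
    (h : Finset Λ → Op Λ d) (hloc : IsLocalInteraction G h)
    (H : Op Λ d) (hH : H = ∑ X : Finset Λ, h X)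
    (heig : ∀ a : Λ → Fin k, ∃ E : ℂ,
      H.toEuclideanLin (weightState C a) = E • weightState C a) :
    ∃ (h₁ P₁ : Λ → Op Λ d) (h₂ P₂ : Sym2 Λ → Op Λ d) (g : Fin (k - 1) → ℂ) (c : ℂ),
      (∀ x, IsLocalAnnihilator C.target {x} (P₁ x)) ∧
      (∀ e ∈ G.edgeFinset, IsLocalAnnihilator C.target e.toFinset (P₂ e)) ∧
      H = ∑ x, h₁ x * P₁ x + ∑ e ∈ G.edgeFinset, h₂ e * P₂ e
          + ∑ x, siteOp x (∑ i, g i • C.gen i) + c • 1 ∧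
      (H.IsHermitian → (∀ i, (g i).im = 0) ∧ c.im = 0) :=
  theorem6p1_general G hG C h hloc.supported hloc.not_allToAll H hH heig
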